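/- Let $G$ be an ordered abelian group. A cut of $G$ is a partition $\Lambda=(\Lambda^L,\Lambda^R)$ of $G$ with every element of $\Lambda^L$ smaller than every element of $\Lambda^R$; cuts are ordered by inclusion of left parts, $\pm\infty$ are the extreme cuts, and $\gamma<\Lambda$, $\gamma>\Lambda$ mean $\gamma\in\Lambda^L$, $\gamma\in\Lambda^R$. Put $\gamma^+=((-\infty,\gamma],(\gamma,\infty))$. For $S\subseteq G$ let $S^+$ be the smallest cut with $S\subseteq (S^+)^L$ and $S^-$ the largest cut with $S\subseteq (S^-)^R$. Put $\Lambda+\Gamma=\{\lambda+\gamma:\lambda<\Lambda,\gamma<\Gamma\}^+$, $\Lambda-\Gamma=\{\lambda-\gamma:\lambda>\Lambda,\gamma<\Gamma\}^-$, $n\Gamma=\Gamma+\dots+\Gamma$ and $\Lambda-n\Gamma=\Lambda-\Gamma-\dots-\Gamma$ ($n$ times); $\gamma+\Lambda$ is the translate of $\Lambda$ by $\gamma\in G$. Let $(K,v)$ be a valued field with value group $G$ and a subfield $k$ mapped isomorphically onto the residue field, and let $t:G\to K^*$ be a section of $v$, i.e. $v(t^\gamma)=\gamma$, $t^{-\gamma}=1/t^\gamma$,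 $t^0=1$. For a valued field $(E,w)$ extending $(K,v)$ with value group $G$, let $\mathcal O_E[\Lambda]=\{x\in E: w(x)>\Lambda\}$. A family $(A[\Lambda])_\Lambda$ of $k$-subspaces of $E$, indexed by the cuts of $G$, is a *weak tower of complements* for $E$ if for all $\gamma,\Gamma,\Lambda$: $A[\Lambda]\oplus\mathcal O_E[\Lambda]=E$; $t^\gamma k\subseteq A[\gamma^+]$; $\Gamma\le\Lambda\iff A[\Gamma]\subseteq A[\Lambda]$; and $A[\gamma+\Lambda]=t^\gamma A[\Lambda]$. It is a *tower of complements* (or *multiplicative*) if it satisfies the first three conditions and $A[\Lambda]A[\Gamma]\subseteq A[\Lambda+\Gamma]$ for all $\Lambda,\Gamma$. Let $A=(A[\Lambda])_\Lambda$ be a tower of complements for $K$. Let $F=K(a)$ be a field extension of $K$ with a valuation, again denoted $v$, that extends that of $K$ and has value group $G$. Assume that $a$ is a limit of a pseudo Cauchy sequence $(a_\nu)_{\nu\in I}$ in $K$ without limit in $K$, and that $a$ is a root of a minimal polynomial of this sequence, i.e. of a polynomial $q\in K[X]$ of least degree $m$ among those for which $v(q(a_\nu))$ is eventually strictly increasing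 (in particular, the sequence is of algebraic type). Let $\Lambda_a=\{v(a-c):c\in K\}^+$. Define a family $B=(B[\Gamma])_\Gamma$ of $k$-subspaces of $F$ as follows. If $\Lambda_a<+\infty$, then $B[\Gamma]$ is the $k$-span of all $ca^n$ with $0\le n<m$ and $c\in A[\Gamma-n\Lambda_a]$. If $\Lambda_a=+\infty$, then $B[\Gamma]=A[\Gamma]$ for $\Gamma<+\infty$ and $B[+\infty]=F$. Then $B$ is a weak tower of complements for $F$ extending $A$, i.e. $B[\Gamma]\cap K=A[\Gamma]$ for every cut $\Gamma$. Moreover, if $p(X)=\sum_{j=0}^m b_jX^j$ (with $b_m=1$) is the minimal polynomial of $a$ over $K$, then $B$ is a tower of complements for $F$ if and only if $\Lambda_a=+\infty$ or $b_j\in A[m\Lambda_a-j\Lambda_a]$ for all $j=0,\dots,m-1$. -/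

import Mathlib

open Polynomial IntermediateField
open scoped Pointwise

namespace TowerOfComplements

noncomputable section

/-! ### Cuts of an ordered abelian group

A cut `Λ = (Λᴸ, Λᴿ)` of a linearly ordered set is determined by its left part `Λᴸ`, a lower set;
the right part is the complement, and `Λ ≤ Γ` means `Λᴸ ⊆ Γᴸ`.  We therefore represent cuts by
`LowerSet G` with its order: `⊤ = +∞`, `⊥ = -∞`, `γ⁺ = LowerSet.Iic γ`, `γ⁻ = LowerSet.Iio γ`.
Mathlib's pointwise operations on `LowerSet G` are the operations on cuts:
`Λ + Γ` is the left sum, the lower set `{λ + γ | λ < Λ, γ < Γ}`;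
`γ +ᵥ Λ` is the translate of `Λ` by `γ`;
`n • Λ` (for `1 ≤ n`) is the `n`-fold left sum of `Λ`. -/

section Cuts

variable (G : Type*) [AddCommGroup G] [LinearOrder G]

/-- The ordered set of cuts of `G`. -/
abbrev Cut := LowerSet G

variable {G}

/-- `S⁺`, the smallest cut having `S` in its left part. -/
def Cut.above (S : Set G) : Cut G := lowerClosure S

/-- `S⁻`, the largest cut having `S` in its right part. -/
def Cut.below (S : Set G) : Cut G := (upperClosure S).compl

/-- The right difference `Λ - Γ = {l - g | l > Λ, g < Γ}⁻`. -/
def Cut.diff (Λ Γ : Cut G) : Cut G :=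
  Cut.below {x | ∃ l : G, l ∉ Λ ∧ ∃ g : G, g ∈ Γ ∧ x = l - g}

/-- `Λ - n Γ`, that is `Λ - Γ - ⋯ - Γ` with `n` right differences. -/
def Cut.diffN (Λ : Cut G) (n : ℕ) (Γ : Cut G) : Cut G :=
  (fun Θ : Cut G => Cut.diff Θ Γ)^[n] Λ

end Cuts

section Valued

variable {G : Type*} [AddCommGroup G] [LinearOrder G] [IsOrderedAddMonoid G]
variable {k E : Type*} [Field k] [Field E] [Algebra k E]

/-- `k` is (the image of) a residue field section of the valued field `(E, v)`:
the elements of `k` lie in the valuation ring `O`, and the composite `k → O → O / M` with the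
residue map is bijective. -/
def IsResidueSection (k : Type*) {E : Type*} [Field k] [Field E] [Algebra k E]
    (v : AddValuation E (WithTop G)) : Prop :=
  (∀ c : k, 0 ≤ v (algebraMap k E c)) ∧
    ∀ x : E, 0 ≤ v x → ∃! c : k, 0 < v (x - algebraMap k E c)

/-- `t` is a value group section of `(E, v)`. In particular the value group of `v` is all of `G`.
No multiplicativity of `t` is required. -/
structure IsValueGroupSection (v : AddValuation E (WithTop G)) (t : G → E) : Prop where
  val : ∀ γ : G, v (t γ) = (γ : WithTop G)
  neg : ∀ γ : G, t (-γ) = (t γ)⁻¹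
  zero : t 0 = 1

/-- The fractional ideal `O[Λ] = {x | v x > Λ}` of the valuation ring, as an additive group. -/
def ideal (v : AddValuation E (WithTop G)) (Λ : Cut G) : AddSubgroup E where
  carrier := {x | ∀ γ ∈ Λ, (γ : WithTop G) < v x}
  zero_mem' := fun γ _ => by simp
  add_mem' := fun {x y} hx hy γ hγ => lt_of_lt_of_le (lt_min (hx γ hγ) (hy γ hγ)) (v.map_add x y)
  neg_mem' := fun {x} hx γ hγ => by
    rw [AddValuation.map_neg]
    exact hx γ hγ

/-- The axioms common to weak towers of complements and towers of complements for `(E, v)`.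
That each `A Λ` is a `k`-subspace is part of the type of `A`. -/
structure IsPreTower (v : AddValuation E (WithTop G)) (t : G → E)
    (A : Cut G → Submodule k E) : Prop where
  /-- `A[Λ] ⊕ O[Λ] = E` -/
  isCompl : ∀ Λ : Cut G, IsCompl (A Λ).toAddSubgroup (ideal v Λ)
  /-- `t^γ k ⊆ A[γ⁺]` -/
  monomial_mem : ∀ (γ : G) (c : k), c • t γ ∈ A (LowerSet.Iic γ)
  /-- `Γ ≤ Λ` if and only if `A[Γ] ⊆ A[Λ]` -/
  le_iff : ∀ Γ Λ : Cut G, Γ ≤ Λ ↔ A Γ ≤ A Λ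

/-- A (`t`-compatible) weak tower of complements for the valued field `(E, v)`. -/
structure IsWeakTower (v : AddValuation E (WithTop G)) (t : G → E)
    (A : Cut G → Submodule k E) : Prop extends IsPreTower v t A where
  /-- `A[γ + Λ] = t^γ A[Λ]` -/
  translate : ∀ (γ : G) (Λ : Cut G), (A (γ +ᵥ Λ) : Set E) = (fun x => t γ * x) '' (A Λ : Set E)

/-- A (`t`-compatible) tower of complements for the valued field `(E, v)`; one also says that the
family `A` is multiplicative. -/
structure IsTower (v : AddValuation E (WithTop G)) (t : G → E)
    (A : Cut G → Submodule k E) : Prop extends IsPreTower v t A where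
  /-- `A[Λ] A[Γ] ⊆ A[Λ + Γ]` -/
  mul_mem : ∀ (Λ Γ : Cut G) (x y : E), x ∈ A Λ → y ∈ A Γ → x * y ∈ A (Λ + Γ)

end Valued

section PseudoCauchy

variable {G : Type*} [AddCommGroup G] [LinearOrder G] [IsOrderedAddMonoid G]
variable {K : Type*} [Field K] {I : Type*} [LinearOrder I]

/-- `u` is a pseudo Cauchy sequence in `(K, v)`. -/
def IsPseudoCauchy (v : AddValuation K (WithTop G)) (u : I → K) : Prop :=
  ∀ ρ σ τ : I, ρ < σ → σ < τ → v (u σ - u ρ) < v (u τ - u σ)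

/-- `a` is a (pseudo) limit of `u`: the value of `a - u ρ` is the common value of the elements
`u σ - u ρ` for `σ > ρ`. -/
def IsPseudoLimit (v : AddValuation K (WithTop G)) (u : I → K) (a : K) : Prop :=
  ∀ ρ σ : I, ρ < σ → v (a - u ρ) = v (u σ - u ρ)

/-- The values `v (f (u ν))` are eventually strictly increasing with `ν`. -/
def EventuallyIncreasesOn (v : AddValuation K (WithTop G)) (u : I → K) (f : K[X]) : Prop :=
  ∃ ν₀ : I, ∀ μ ν : I, ν₀ ≤ μ → μ < ν → v (f.eval (u μ)) < v (f.eval (u ν))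

/-- `q` is a minimal polynomial for the sequence `u`: a polynomial of least degree among those
whose values along `u` are eventually strictly increasing. (A pseudo Cauchy sequence is of
algebraic type when there is such a polynomial.) -/
def IsMinimalPolynomialOf (v : AddValuation K (WithTop G)) (u : I → K) (q : K[X]) : Prop :=
  EventuallyIncreasesOn v u q ∧
    ∀ f : K[X], EventuallyIncreasesOn v u f → q.natDegree ≤ f.natDegree

end PseudoCauchy

section Extension

variable {G : Type*} [AddCommGroup G] [LinearOrder G] [IsOrderedAddMonoid G]

/-- The cut `Λ_a = {v (a - c) | c ∈ K}⁺`. -/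
def breadth (K : Type*) {F : Type*} [Field K] [Field F] [Algebra K F]
    (w : AddValuation F (WithTop G)) (a : F) : Cut G :=
  Cut.above {γ : G | ∃ c : K, w (a - algebraMap K F c) = (γ : WithTop G)}

variable {k K F : Type*} [Field k] [Field K] [Field F]
  [Algebra k K] [Algebra K F] [Algebra k F] [IsScalarTower k K F]

open Classical in
/-- The family `B` of `k`-subspaces of `F = K(a)` built from the family `A` of `k`-subspaces of
`K`, where `Θ` stands for `Λ_a` and `m` for the degree of `a` over `K`.

If `Θ < +∞`, then `B[Γ]` is spanned by the monomials `c a ^ n` with `n < m` and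
`c ∈ A[Γ - n Θ]` (the case `n = 0` gives `A[Γ] ⊆ B[Γ]`).
If `Θ = +∞`, then `B[Γ] = A[Γ]` for `Γ < +∞`, and `B[+∞]` is the whole field. -/
def extension (A : Cut G → Submodule k K) (Θ : Cut G) (m : ℕ) (a : F) (Γ : Cut G) :
    Submodule k F :=
  if Θ = ⊤ then
    if Γ = ⊤ then ⊤
    else (A Γ).map (IsScalarTower.toAlgHom k K F).toLinearMap
  else
    Submodule.span k
      {x : F | ∃ n : ℕ, n < m ∧ ∃ c ∈ A (Cut.diffN Γ n Θ), x = algebraMap K F c * a ^ n}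

end Extension

end

end TowerOfComplements

/-! Write Λ for `Λ_a` and f_i for the i-th Hasse derivative of f. In both cases of its definition,
B[Γ] consists of the f(a) with deg f < m and n-th coefficient in A[Γ - nΛ] (`mem_extension_iff`).
Cuts enter mainly through the adjunction `Cut.le_diffN_iff` between Δ ↦ Δ + nΛ and Γ ↦ Γ - nΛ.

B[Γ] + O[Γ] = F (`exists_add_eq_aeval`): the part r of a leading coefficient lying in O[Γ - nΛ] is
removed by subtracting r(X - c)^n instead of rX^n, with c ∈ K so close to a that r(a - c)^n ∈ O[Γ].

B[Γ] ∩ O[Γ] = 0 (`eq_zero_of_aeval_mem_ideal`): by Kaplansky's dichotomy and the minimality of m,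
every nonzero f of degree < m satisfies v(f(a)) < v(f_i(a)) + iγ for some γ < Λ and all i > 0. Hence
f_i(c) and f_i(a) have the same value for c near a. If f(a) ∈ O[Γ], this puts f_i(c) into O[Γ - iΛ].
Choosing c in A[Λ], multiplicativity of A puts f_i(c) into A[Γ - iΛ] as well, so the whole Taylor
expansion of f at c vanishes.

The criterion concerns the rewriting of a^m by lower powers. Multiplicativity of B forces a^m ∈
B[mΛ], and uniqueness of representation reads off the b_j; conversely, the condition on the b_j lets
every monomial of high degree be reduced within B. If Λ = +∞ the condition is automatic, since A[+∞]
= K. -/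

namespace TowerOfComplements

/-! ### Arithmetic of cuts -/

namespace Cut

variable {G : Type*} [AddCommGroup G] [LinearOrder G]

theorem mem_zero {x : G} : x ∈ (0 : Cut G) ↔ x ≤ 0 := Iff.rfl

@[simp]
theorem diffN_zero (Λ Γ : Cut G) : Cut.diffN Λ 0 Γ = Λ := rfl

theorem mem_diff [IsOrderedAddMonoid G] {Λ Γ : Cut G} {x : G} :
    x ∈ Cut.diff Λ Γ ↔ ∀ g ∈ Γ, x + g ∈ Λ := by
  unfold Cut.diff Cut.below
  rw [UpperSet.mem_compl_iff, mem_upperClosure]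
  constructor
  · intro h g hg
    by_contra hx
    exact h ⟨x, ⟨x + g, hx, g, hg, by simp⟩, le_rfl⟩
  · rintro h ⟨y, ⟨l, hl, g, hg, rfl⟩, hy⟩
    exact hl (Λ.lower (sub_le_iff_le_add.mp hy) (h g hg))

variable [IsOrderedAddMonoid G]

theorem add_le_add {Λ Λ' Γ Γ' : Cut G} (h : Λ ≤ Λ') (h' : Γ ≤ Γ') : Λ + Γ ≤ Λ' + Γ' := by
  rintro x ⟨l, hl, g, hg, rfl⟩
  exact ⟨l, h hl, g, h' hg, rfl⟩

theorem le_diff_iff {Δ Λ Γ : Cut G} : Δ ≤ Cut.diff Λ Γ ↔ Δ + Γ ≤ Λ := by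
  constructor
  · rintro h x ⟨l, hl, g, hg, rfl⟩
    exact mem_diff.mp (h hl) g hg
  · intro h x hx
    exact mem_diff.mpr fun g hg => h ⟨x, hx, g, hg, rfl⟩

/-- `Λ - n Γ` is the largest cut `Δ` with `Δ + n Γ ≤ Λ`. -/
theorem le_diffN_iff {Δ Λ Γ : Cut G} {n : ℕ} : Δ ≤ Cut.diffN Λ n Γ ↔ Δ + n • Γ ≤ Λ := by
  induction n generalizing Λ with
  | zero => simp
  | succ n ih =>
    have : Cut.diffN Λ (n + 1) Γ = Cut.diffN (Cut.diff Λ Γ) n Γ := rfl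
    rw [this, ih, le_diff_iff, succ_nsmul, add_assoc]

theorem diffN_add_le (Λ Γ : Cut G) (n : ℕ) : Cut.diffN Λ n Γ + n • Γ ≤ Λ :=
  le_diffN_iff.mp le_rfl

theorem Iic_add (γ : G) (Λ : Cut G) : LowerSet.Iic γ + Λ = γ +ᵥ Λ := by
  ext x
  constructor
  · rintro ⟨l, hl, g, hg, rfl⟩
    refine ⟨l - γ + g, Λ.lower ?_ hg, by simp only [vadd_eq_add]; abel⟩
    have : l ≤ γ := hl
    simpa using this
  · rintro ⟨g, hg, rfl⟩
    exact ⟨γ, le_rfl, g, hg, rfl⟩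

theorem mem_vadd {γ x : G} {Λ : Cut G} : x ∈ γ +ᵥ Λ ↔ x - γ ∈ Λ := by
  constructor
  · rintro ⟨g, hg, rfl⟩
    simpa using hg
  · intro h
    exact ⟨x - γ, h, by simp⟩

theorem mem_diffN {Λ Γ : Cut G} {n : ℕ} {x : G} :
    x ∈ Cut.diffN Λ n Γ ↔ ∀ g ∈ n • Γ, x + g ∈ Λ := by
  rw [← LowerSet.Iic_le, le_diffN_iff, Iic_add]
  constructor
  · exact fun h g hg => h ⟨g, hg, rfl⟩
  · rintro h _ ⟨g, hg, rfl⟩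
    exact h g hg

theorem diffN_mono {Λ Λ' : Cut G} (h : Λ ≤ Λ') (n : ℕ) (Γ : Cut G) :
    Cut.diffN Λ n Γ ≤ Cut.diffN Λ' n Γ :=
  fun _ hx => mem_diffN.mpr fun g hg => h (mem_diffN.mp hx g hg)

theorem diffN_vadd (γ : G) (Λ : Cut G) (n : ℕ) (Γ : Cut G) :
    Cut.diffN (γ +ᵥ Λ) n Γ = γ +ᵥ Cut.diffN Λ n Γ := by
  ext x
  simp only [SetLike.mem_coe, mem_diffN, mem_vadd, sub_add_eq_add_sub]

theorem nsmul_mem_nsmul {Γ : Cut G} {γ : G} (h : γ ∈ Γ) (n : ℕ) : n • γ ∈ n • Γ := by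
  induction n with
  | zero => simp [mem_zero]
  | succ n ih =>
    rw [succ_nsmul, succ_nsmul]
    exact ⟨_, ih, _, h, rfl⟩

/-- Replace every summand by the largest one. Nonemptiness of Γ is needed only for n = 0. -/
theorem exists_le_nsmul {Γ : Cut G} (hΓ : ∃ γ, γ ∈ Γ) {n : ℕ} {g : G} (hg : g ∈ n • Γ) :
    ∃ γ ∈ Γ, g ≤ n • γ := by
  induction n generalizing g with
  | zero =>
    obtain ⟨γ, hγ⟩ := hΓ
    rw [zero_nsmul] at hg
    exact ⟨γ, hγ, by simpa [mem_zero] using hg⟩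
  | succ n ih =>
    rw [succ_nsmul] at hg
    obtain ⟨l, hl, g, hg, rfl⟩ := hg
    obtain ⟨γ, hγ, hle⟩ := ih hl
    refine ⟨max γ g, ?_, ?_⟩
    · rcases max_choice γ g with h | h <;> rw [h] <;> assumption
    · rw [succ_nsmul]
      exact _root_.add_le_add (hle.trans (nsmul_le_nsmul_right (le_max_left _ _) n))
        (le_max_right _ _)

theorem diffN_top_left (n : ℕ) (Γ : Cut G) : Cut.diffN ⊤ n Γ = ⊤ := by
  ext x
  simp [mem_diffN]

theorem nsmul_top {n : ℕ} (hn : 0 < n) : n • (⊤ : Cut G) = ⊤ := by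
  obtain ⟨n, rfl⟩ := Nat.exists_eq_succ_of_ne_zero hn.ne'
  rw [eq_top_iff]
  intro x _
  rw [Nat.succ_eq_add_one, succ_nsmul]
  exact ⟨n • (0 : G), nsmul_mem_nsmul (by simp) n, x, by simp, by simp⟩

/-- This makes the case Λ_a = +∞ uniform with the other one: coefficients of positive index are
forced into A[-∞] = 0. -/
theorem diffN_top_right {Λ : Cut G} (hΛ : Λ ≠ ⊤) {n : ℕ} (hn : 0 < n) :
    Cut.diffN Λ n ⊤ = ⊥ := by
  rw [eq_bot_iff]
  intro x hx
  refine absurd ?_ hΛ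
  rw [eq_top_iff]
  intro y _
  rw [SetLike.mem_coe, mem_diffN, nsmul_top hn] at hx
  simpa using hx (y - x) (by simp)

end Cut

/-! ### Taylor expansion and Kaplansky's dichotomy -/

open Filter

theorem aeval_eq_sum_hasseDeriv {K F : Type*} [Field K] [Field F] [Algebra K F] (f : K[X])
    (a x : F) :
    aeval x f = ∑ i ∈ Finset.range (f.natDegree + 1),
      aeval a (hasseDeriv i f) * (x - a) ^ i := by
  have h := taylor_eval_sub (f.map (algebraMap K F)) (r := a) x
  rw [eval_map_algebraMap] at h
  rw [← h, eval_eq_sum_range, natDegree_taylor, natDegree_map]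
  refine Finset.sum_congr rfl fun i _ => ?_
  rw [taylor_coeff, ← eval_map_algebraMap]
  congr 2
  ext n
  simp [hasseDeriv_coeff]

/-- Two lines of different slopes cross at most once: as soon as the line of smaller slope is not
above the other, it stays strictly below from then on. So any two lines are eventually strictly
comparable, and induction on the finite set gives the minimum. -/
theorem exists_eventually_unique_min {G I : Type*} [AddCommGroup G] [LinearOrder G]
    [IsOrderedAddMonoid G] [LinearOrder I] [Nonempty I] [NoMaxOrder I] {g : I → G}
    (hg : StrictMono g) (β : ℕ → G) (S : Finset ℕ) (hS : S.Nonempty) :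
    ∃ i ∈ S, ∀ᶠ ν in atTop, ∀ j ∈ S, j ≠ i → β i + i • g ν < β j + j • g ν := by
  have key : ∀ i j : ℕ, i < j → (∀ᶠ ν in atTop, β i + i • g ν < β j + j • g ν) ∨
      ∀ᶠ ν in atTop, β j + j • g ν < β i + i • g ν := by
    intro i j hij
    obtain ⟨n, rfl⟩ := Nat.exists_eq_add_of_lt hij
    by_cases h : ∃ ν₀, β i + i • g ν₀ ≤ β (i + n + 1) + (i + n + 1) • g ν₀
    · left
      obtain ⟨ν₀, h₀⟩ := h
      filter_upwards [eventually_gt_atTop ν₀] with ν hν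
      have h1 : (n + 1) • g ν₀ < (n + 1) • g ν := nsmul_lt_nsmul_right (by omega) (hg hν)
      rw [add_assoc i n 1, add_nsmul] at h₀ ⊢
      have h2 : β i ≤ β (i + (n + 1)) + (n + 1) • g ν₀ := by
        have := sub_le_sub_right h₀ (i • g ν₀)
        simpa [add_sub_assoc, add_comm, add_left_comm] using this
      calc β i + i • g ν ≤ β (i + (n + 1)) + (n + 1) • g ν₀ + i • g ν := by gcongr
        _ < β (i + (n + 1)) + (n + 1) • g ν + i • g ν := by gcongr
        _ = _ := by abel
    · push Not at h
      exact Or.inr (Eventually.of_forall h)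
  have key' : ∀ i j : ℕ, i ≠ j → (∀ᶠ ν in atTop, β i + i • g ν < β j + j • g ν) ∨
      ∀ᶠ ν in atTop, β j + j • g ν < β i + i • g ν := by
    intro i j hij
    rcases hij.lt_or_gt with h | h
    · exact key i j h
    · exact (key j i h).symm
  induction hS using Finset.Nonempty.cons_induction with
  | singleton a => exact ⟨a, by simp, by simp⟩
  | cons a S ha hS ih =>
    obtain ⟨i, hi, hmin⟩ := ih
    have hai : a ≠ i := fun h => ha (h ▸ hi)
    rcases key' a i hai with h | h
    · refine ⟨a, by simp, ?_⟩
      filter_upwards [h, hmin] with ν h1 h2 j hj hja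
      rcases Finset.mem_cons.mp hj with rfl | hj
      · exact absurd rfl hja
      · by_cases hji : j = i
        · rwa [hji]
        · exact h1.trans (h2 j hj hji)
    · refine ⟨i, by simp [hi], ?_⟩
      filter_upwards [h, hmin] with ν h1 h2 j hj hji
      rcases Finset.mem_cons.mp hj with rfl | hj
      · exact h1
      · exact h2 j hj hji

section

variable {G : Type*} [AddCommGroup G] [LinearOrder G] [IsOrderedAddMonoid G]

theorem map_sum_eq_of_lt {F : Type*} [Field F] (w : AddValuation F (WithTop G)) {ι : Type*}
    [DecidableEq ι] {s : Finset ι} {f : ι → F} {i : ι} (hi : i ∈ s) (hf : f i ≠ 0)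
    (h : ∀ j ∈ s, j ≠ i → w (f i) < w (f j)) : w (∑ j ∈ s, f j) = w (f i) := by
  rw [← Finset.add_sum_erase s f hi]
  refine w.map_add_eq_of_lt_left (w.map_lt_sum (w.ne_top_iff.mpr hf) fun j hj => ?_)
  exact h j (Finset.mem_of_mem_erase hj) (Finset.ne_of_mem_erase hj)

variable {K F : Type*} [Field K] [Field F] [Algebra K F]
  {v : AddValuation K (WithTop G)} {w : AddValuation F (WithTop G)}

/-- If `w (f a) < w (f_i a) + i w (a - c)` for the higher Taylor coefficients `f_i a` of `f` at
`a`, then `f c` and `f a` have the same value. -/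
theorem map_eval_eq (hw : ∀ x : K, w (algebraMap K F x) = v x) {a : F} {f : K[X]} {c : K} {γ : G}
    (hγ : (γ : WithTop G) ≤ w (a - algebraMap K F c)) (hf : aeval a f ≠ 0)
    (h : ∀ i, 0 < i → w (aeval a f) < w (aeval a (hasseDeriv i f)) + i • (γ : WithTop G)) :
    v (f.eval c) = w (aeval a f) := by
  rw [← hw, ← aeval_algebraMap_apply_eq_algebraMap_eval, aeval_eq_sum_hasseDeriv f a,
    map_sum_eq_of_lt w (i := 0) (by simp)]
  · simp
  · simpa using hf
  · intro j _ hj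
    rw [hasseDeriv_zero', pow_zero, mul_one, w.map_mul, w.map_pow, w.map_sub_swap]
    refine (h j (Nat.pos_of_ne_zero hj)).trans_le ?_
    gcongr

variable {I : Type*} [LinearOrder I] [NoMaxOrder I] {u : I → K}

theorem exists_strictMono_eq_map_sub (hw : ∀ x : K, w (algebraMap K F x) = v x)
    (hu : IsPseudoCauchy v u) {a : F} (hlim : IsPseudoLimit w (fun ν => algebraMap K F (u ν)) a) :
    ∃ g : I → G, StrictMono g ∧ ∀ ν, w (a - algebraMap K F (u ν)) = g ν := by
  have h : ∀ ρ σ, ρ < σ → w (a - algebraMap K F (u ρ)) < w (a - algebraMap K F (u σ)) := by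
    intro ρ σ hρσ
    obtain ⟨τ, hτ⟩ := exists_gt σ
    have h1 := hlim ρ σ hρσ
    have h2 := hlim σ τ hτ
    simp only [← map_sub, hw] at h1 h2
    rw [h1, h2]
    exact hu ρ σ τ hρσ hτ
  have hne : ∀ ρ, w (a - algebraMap K F (u ρ)) ≠ ⊤ := fun ρ => by
    obtain ⟨σ, hσ⟩ := exists_gt ρ
    exact (h ρ σ hσ).ne_top
  choose g hg using fun ρ => WithTop.ne_top_iff_exists.mp (hne ρ)
  refine ⟨g, fun ρ σ hρσ => ?_, fun ν => (hg ν).symm⟩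
  have := h ρ σ hρσ
  rwa [← hg, ← hg, WithTop.coe_lt_coe] at this

variable [Nonempty I]

/-- Kaplansky's dichotomy: along a pseudo Cauchy sequence with limit `a`, either the value of `f`
is eventually that of `f a`, or it is eventually increasing. -/
theorem eventually_lt_or_eventuallyIncreasesOn (hw : ∀ x : K, w (algebraMap K F x) = v x)
    {a : F} {g : I → G} (hg : StrictMono g) (hag : ∀ ν, w (a - algebraMap K F (u ν)) = g ν)
    {f : K[X]} (hf : f ≠ 0) :
    (aeval a f ≠ 0 ∧ ∀ᶠ ν in atTop, ∀ i, 0 < i →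
        w (aeval a f) < w (aeval a (hasseDeriv i f)) + i • (g ν : WithTop G)) ∨
      EventuallyIncreasesOn v u f := by
  classical
  set β : ℕ → F := fun i => aeval a (hasseDeriv i f) with hβ
  set S := (Finset.range (f.natDegree + 1)).filter fun i => β i ≠ 0 with hSdef
  have hS : S.Nonempty := ⟨f.natDegree, by
    simp [hSdef, hβ, hasseDeriv_natDegree_eq_C, hf]⟩
  have hmemS : ∀ j, β j ≠ 0 → j ∈ S := by
    intro j hj
    refine Finset.mem_filter.mpr ⟨?_, hj⟩
    by_contra hlt
    refine hj ?_
    rw [hβ]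
    simp only
    rw [hasseDeriv_eq_zero_of_lt_natDegree f j (by simpa [Nat.lt_succ_iff] using hlt), map_zero]
  -- On S the coefficients are nonzero, so the default value of `untopD` is never taken.
  have hval : ∀ j ∈ S, (((w (β j)).untopD 0 : G) : WithTop G) = w (β j) := by
    intro j hj
    have := w.ne_top_iff.mpr (Finset.mem_filter.mp hj).2
    lift w (β j) to G using this with x
    rfl
  obtain ⟨i, hi, hmin⟩ := exists_eventually_unique_min hg (fun j => (w (β j)).untopD 0) S hS
  have hi0 : β i ≠ 0 := (Finset.mem_filter.mp hi).2
  have hmin' : ∀ᶠ ν in atTop, ∀ j, j ≠ i →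
      w (β i) + i • (g ν : WithTop G) < w (β j) + j • (g ν : WithTop G) := by
    filter_upwards [hmin] with ν hν j hji
    by_cases hj : β j = 0
    · rw [hj, w.map_zero, top_add, ← hval i hi, ← WithTop.coe_nsmul, ← WithTop.coe_add]
      exact WithTop.coe_lt_top _
    · have := hν j (hmemS j hj) hji
      rw [← hval i hi, ← hval j (hmemS j hj), ← WithTop.coe_nsmul, ← WithTop.coe_nsmul,
        ← WithTop.coe_add, ← WithTop.coe_add, WithTop.coe_lt_coe]
      exact this
  -- If the constant Taylor term dominates, the first alternative holds; a dominating term of index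
  -- i > 0 gives f(u ν) the value w(β i) + i g(ν), which increases with ν.
  rcases Nat.eq_zero_or_pos i with rfl | hipos
  · left
    simp only [hβ, hasseDeriv_zero'] at hi0 hmin'
    refine ⟨hi0, ?_⟩
    filter_upwards [hmin'] with ν hν j hj
    simpa using hν j hj.ne'
  · right
    have heq : ∀ᶠ ν in atTop, v (f.eval (u ν)) = ((w (β i)).untopD 0 + i • g ν : G) := by
      filter_upwards [hmin'] with ν hν
      rw [← hw, ← aeval_algebraMap_apply_eq_algebraMap_eval, aeval_eq_sum_hasseDeriv f a]
      have hterm : ∀ j, w (aeval a (hasseDeriv j f) * (algebraMap K F (u ν) - a) ^ j) =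
          w (β j) + j • (g ν : WithTop G) := by
        intro j
        rw [w.map_mul, w.map_pow, w.map_sub_swap, hag]
      rw [map_sum_eq_of_lt w (i := i) (Finset.mem_filter.mp hi).1, hterm, WithTop.coe_add,
        WithTop.coe_nsmul, hval i hi]
      · refine mul_ne_zero hi0 (pow_ne_zero _ ?_)
        rw [← w.ne_top_iff, w.map_sub_swap, hag]
        exact WithTop.coe_ne_top
      · intro j _ hj
        rw [hterm, hterm]
        exact hν j hj
    obtain ⟨ν₀, hν₀⟩ := eventually_atTop.mp heq
    refine ⟨ν₀, fun μ ν hμ hμν => ?_⟩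
    rw [hν₀ μ hμ, hν₀ ν (hμ.trans hμν.le), WithTop.coe_lt_coe]
    have := nsmul_lt_nsmul_right hipos.ne' (hg hμν)
    gcongr

/-- The minimal polynomial of a vanishes at a, so the dichotomy leaves only increasing values for
it, and minimality of q bounds its degree from below. -/
theorem IsMinimalPolynomialOf.natDegree_minpoly (hw : ∀ x : K, w (algebraMap K F x) = v x)
    {a : F} {g : I → G} (hg : StrictMono g) (hag : ∀ ν, w (a - algebraMap K F (u ν)) = g ν)
    {q : K[X]} (hq : IsMinimalPolynomialOf v u q) (hroot : aeval a q = 0) :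
    IsIntegral K a ∧ (minpoly K a).natDegree = q.natDegree := by
  have hq0 : q ≠ 0 := by
    rintro rfl
    obtain ⟨ν₀, h⟩ := hq.1
    obtain ⟨ν, hν⟩ := exists_gt ν₀
    simpa using h ν₀ ν le_rfl hν
  have hint : IsIntegral K a := IsAlgebraic.isIntegral ⟨q, hq0, hroot⟩
  refine ⟨hint, le_antisymm (natDegree_le_of_dvd (minpoly.dvd K a hroot) hq0) (hq.2 _ ?_)⟩
  rcases eventually_lt_or_eventuallyIncreasesOn hw hg hag (minpoly.ne_zero hint) with h | h
  · exact absurd (minpoly.aeval K a) h.1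
  · exact h

theorem IsMinimalPolynomialOf.eventually_lt (hw : ∀ x : K, w (algebraMap K F x) = v x)
    {a : F} {g : I → G} (hg : StrictMono g) (hag : ∀ ν, w (a - algebraMap K F (u ν)) = g ν)
    {q : K[X]} (hq : IsMinimalPolynomialOf v u q) {f : K[X]} (hf : f ≠ 0)
    (hdeg : f.natDegree < q.natDegree) :
    aeval a f ≠ 0 ∧ ∀ᶠ ν in atTop, ∀ i, 0 < i →
      w (aeval a f) < w (aeval a (hasseDeriv i f)) + i • (g ν : WithTop G) :=
  (eventually_lt_or_eventuallyIncreasesOn hw hg hag hf).resolve_right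
    fun h => hdeg.not_ge (hq.2 f h)

end

/-! ### Complements and ideals -/

section

variable {G : Type*} [AddCommGroup G] [LinearOrder G] [IsOrderedAddMonoid G]
variable {k E : Type*} [Field k] [Field E] [Algebra k E]
  {v : AddValuation E (WithTop G)} {t : G → E} {A : Cut G → Submodule k E}

theorem mem_ideal_of_notMem {Λ : Cut G} {x : E} {γ : G} (hγ : γ ∉ Λ)
    (hx : (γ : WithTop G) ≤ v x) : x ∈ ideal v Λ := fun δ hδ => by
  refine lt_of_lt_of_le (WithTop.coe_lt_coe.mpr ?_) hx
  by_contra h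
  exact hγ (Λ.lower (not_lt.mp h) hδ)

theorem eq_zero_of_mem_ideal_top {x : E} (hx : x ∈ ideal v (⊤ : Cut G)) :
    x = 0 := by
  by_contra h
  obtain ⟨γ, hγ⟩ := WithTop.ne_top_iff_exists.mp (v.ne_top_iff.mpr h)
  have := hx γ (by simp)
  rw [hγ] at this
  exact lt_irrefl _ this

/-- Elements of `O[Γ - n Θ]` are moved into `O[Γ]` by `n`-th powers of elements of large value
in `Θ`. -/
theorem exists_mul_pow_mem_ideal {Γ Θ : Cut G} (hΘ : ∃ γ, γ ∈ Θ) {n : ℕ} {x : E}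
    (hx : x ∈ ideal v (Cut.diffN Γ n Θ)) :
    ∃ γ ∈ Θ, ∀ y : E, (γ : WithTop G) ≤ v y → x * y ^ n ∈ ideal v Γ := by
  by_cases h : v x = ⊤
  · obtain ⟨γ, hγ⟩ := hΘ
    refine ⟨γ, hγ, fun y _ δ _ => ?_⟩
    rw [v.map_mul, h, top_add]
    exact WithTop.coe_lt_top _
  · obtain ⟨ρ, hρ⟩ := WithTop.ne_top_iff_exists.mp h
    have hρΓ : ρ ∉ Cut.diffN Γ n Θ := fun hmem => by
      have := hx ρ hmem
      rw [hρ] at this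
      exact lt_irrefl _ this
    rw [Cut.mem_diffN] at hρΓ
    push Not at hρΓ
    obtain ⟨g, hg, hgΓ⟩ := hρΓ
    obtain ⟨γ, hγ, hle⟩ := Cut.exists_le_nsmul hΘ hg
    refine ⟨γ, hγ, fun y hy => mem_ideal_of_notMem hgΓ ?_⟩
    rw [v.map_mul, v.map_pow, ← hρ, WithTop.coe_add]
    gcongr
    calc (g : WithTop G) ≤ ((n • γ : G) : WithTop G) := WithTop.coe_le_coe.mpr hle
      _ = n • (γ : WithTop G) := WithTop.coe_nsmul _ _
      _ ≤ n • v y := nsmul_le_nsmul_right hy n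

namespace IsPreTower

variable (hA : IsPreTower v t A)
include hA

theorem mono {Γ Λ : Cut G} (h : Γ ≤ Λ) : A Γ ≤ A Λ := (hA.le_iff Γ Λ).mp h

theorem eq_zero_of_mem {Λ : Cut G} {x : E} (hx : x ∈ A Λ) (hx' : x ∈ ideal v Λ) : x = 0 :=
  AddSubgroup.mem_bot.mp ((hA.isCompl Λ).disjoint.le_bot ⟨hx, hx'⟩)

theorem exists_add_eq (Λ : Cut G) (x : E) : ∃ y ∈ A Λ, ∃ z ∈ ideal v Λ, y + z = x :=
  AddSubgroup.mem_sup.mp ((hA.isCompl Λ).codisjoint.top_le (AddSubgroup.mem_top x))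

theorem eq_zero_of_mem_bot {x : E} (hx : x ∈ A ⊥) : x = 0 :=
  hA.eq_zero_of_mem hx fun _ hγ => absurd hγ (by simp)

theorem mem_top (x : E) : x ∈ A ⊤ := by
  obtain ⟨y, hy, z, hz, rfl⟩ := hA.exists_add_eq ⊤ x
  rw [eq_zero_of_mem_ideal_top hz, add_zero]
  exact hy

theorem one_mem (ht : t 0 = 1) : (1 : E) ∈ A 0 := by
  have := hA.monomial_mem 0 1
  rwa [one_smul, ht, LowerSet.Iic_zero] at this

end IsPreTower

/-- A monotone family containing the monomials is a pretower as soon as it consists of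
complements. -/
theorem IsPreTower.of_isCompl (ht : ∀ γ : G, v (t γ) = (γ : WithTop G))
    (hcompl : ∀ Λ : Cut G, IsCompl (A Λ).toAddSubgroup (ideal v Λ))
    (hmon : ∀ (γ : G) (c : k), c • t γ ∈ A (LowerSet.Iic γ))
    (hmono : ∀ Γ Λ : Cut G, Γ ≤ Λ → A Γ ≤ A Λ) : IsPreTower v t A where
  isCompl := hcompl
  monomial_mem := hmon
  le_iff Γ Λ := by
    refine ⟨hmono Γ Λ, fun h γ hγ => ?_⟩
    -- For γ in Γ but not in Λ, the element t γ would lie in both summands A Λ and O[Λ].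
    by_contra hγΛ
    have h1 : t γ ∈ A Λ := h (hmono _ _ (LowerSet.Iic_le.mpr hγ) (by simpa using hmon γ 1))
    have h2 : t γ ∈ ideal v Λ := mem_ideal_of_notMem hγΛ (ht γ).ge
    have h3 : t γ = 0 := AddSubgroup.mem_bot.mp ((hcompl Λ).disjoint.le_bot ⟨h1, h2⟩)
    have := ht γ
    rw [h3, v.map_zero] at this
    exact WithTop.top_ne_coe this

namespace IsTower

variable (hA : IsTower v t A)
include hA

theorem mul_mem_of_le {Λ Γ Δ : Cut G} {x y : E} (hx : x ∈ A Λ) (hy : y ∈ A Γ)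
    (h : Λ + Γ ≤ Δ) : x * y ∈ A Δ :=
  hA.mono h (hA.mul_mem _ _ _ _ hx hy)

theorem pow_mem (ht : t 0 = 1) {Λ : Cut G} {x : E} (hx : x ∈ A Λ) (n : ℕ) :
    x ^ n ∈ A (n • Λ) := by
  induction n with
  | zero => simpa using hA.one_mem ht
  | succ n ih =>
    rw [pow_succ, succ_nsmul]
    exact hA.mul_mem _ _ _ _ ih hx

theorem monomial_mul_mem (γ : G) {Λ : Cut G} {x : E} (hx : x ∈ A Λ) :
    t γ * x ∈ A (γ +ᵥ Λ) := by
  rw [← Cut.Iic_add]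
  exact hA.mul_mem _ _ _ _ (by simpa using hA.monomial_mem γ 1) hx

end IsTower

end

/-! ### B[Γ] is a complement of O[Γ] -/

section Extension

variable {G : Type*} [AddCommGroup G] [LinearOrder G] [IsOrderedAddMonoid G]
variable {k K F : Type*} [Field k] [Field K] [Field F]
  [Algebra k K] [Algebra K F] [Algebra k F] [IsScalarTower k K F]
  {v : AddValuation K (WithTop G)} {t : G → K} {w : AddValuation F (WithTop G)}
  {A : Cut G → Submodule k K} {Θ : Cut G} {m : ℕ} {a : F}

/-- Polynomials of degree less than `m` whose coefficient of `X ^ n` lies in `A[Γ - n Θ]`. -/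
def coeffSubmodule (A : Cut G → Submodule k K) (Θ : Cut G) (m : ℕ) (Γ : Cut G) :
    Submodule k K[X] where
  carrier := {f | f.degree < m ∧ ∀ n, f.coeff n ∈ A (Cut.diffN Γ n Θ)}
  zero_mem' := ⟨by simp, fun n => by simp⟩
  add_mem' := fun {f g} hf hg => ⟨(degree_add_le f g).trans_lt (max_lt hf.1 hg.1),
    fun n => by simpa using add_mem (hf.2 n) (hg.2 n)⟩
  smul_mem' := fun c f hf => ⟨(degree_smul_le c f).trans_lt hf.1,
    fun n => by simpa using (A _).smul_mem c (hf.2 n)⟩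

omit [IsOrderedAddMonoid G] in
theorem monomial_mem_coeffSubmodule {Γ : Cut G} {n : ℕ} (hn : n < m) {c : K}
    (hc : c ∈ A (Cut.diffN Γ n Θ)) : monomial n c ∈ coeffSubmodule A Θ m Γ := by
  refine ⟨(degree_monomial_le n c).trans_lt (by exact_mod_cast hn), fun i => ?_⟩
  rw [coeff_monomial]
  split_ifs with h
  · rwa [← h]
  · exact zero_mem _

theorem coeffSubmodule_mono (hA : IsPreTower v t A) {Γ Δ : Cut G} (h : Γ ≤ Δ) :
    coeffSubmodule A Θ m Γ ≤ coeffSubmodule A Θ m Δ :=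
  fun _ hf => ⟨hf.1, fun n => hA.mono (Cut.diffN_mono h n Θ) (hf.2 n)⟩

/-- The two cases in the definition of `extension` have a common description. -/
theorem mem_extension_iff (hA : IsPreTower v t A) (hm : 0 < m)
    (hF : ∀ x : F, ∃ f : K[X], f.degree < m ∧ aeval a f = x) {Γ : Cut G} {x : F} :
    x ∈ extension A Θ m a Γ ↔ ∃ f ∈ coeffSubmodule A Θ m Γ, aeval a f = x := by
  unfold extension
  split_ifs with hΘ hΓ
  · subst hΓ
    refine ⟨fun _ => ?_, fun _ => Submodule.mem_top⟩
    obtain ⟨f, hf, rfl⟩ := hF x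
    refine ⟨f, ⟨hf, fun n => ?_⟩, rfl⟩
    rw [Cut.diffN_top_left]
    exact hA.mem_top _
  · subst hΘ
    constructor
    · rintro ⟨c, hc, rfl⟩
      exact ⟨monomial 0 c, monomial_mem_coeffSubmodule hm (by simpa using hc), by simp⟩
    · rintro ⟨f, hf, rfl⟩
      refine ⟨f.coeff 0, by simpa using hf.2 0, ?_⟩
      have : f = C (f.coeff 0) := by
        ext n
        rcases Nat.eq_zero_or_pos n with rfl | hn
        · simp
        · have := hf.2 n
          rw [Cut.diffN_top_right hΓ hn] at this
          rw [hA.eq_zero_of_mem_bot this, coeff_C_of_ne_zero hn.ne']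
      rw [this]
      simp
  · constructor
    · intro hx
      suffices h : Submodule.span k {x : F | ∃ n : ℕ, n < m ∧ ∃ c ∈ A (Cut.diffN Γ n Θ),
          x = algebraMap K F c * a ^ n} ≤ (coeffSubmodule A Θ m Γ).map
            ((aeval a : K[X] →ₐ[K] F).toLinearMap.restrictScalars k) from h hx
      rw [Submodule.span_le]
      rintro _ ⟨n, hn, c, hc, rfl⟩
      exact ⟨monomial n c, monomial_mem_coeffSubmodule hn hc, by simp [aeval_monomial]⟩
    · rintro ⟨f, hf, rfl⟩
      have hdeg : f.natDegree < m := by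
        by_cases h0 : f = 0
        · simpa [h0] using hm
        · exact (natDegree_lt_iff_degree_lt h0).mpr hf.1
      rw [aeval_eq_sum_range' hdeg]
      refine sum_mem fun n hn => Submodule.subset_span ?_
      exact ⟨n, Finset.mem_range.mp hn, _, hf.2 n, by rw [Algebra.smul_def]⟩

section Complement

variable (hw : ∀ x : K, w (algebraMap K F x) = v x) (hne : ∃ γ, γ ∈ Θ)
  (hle : ∀ γ ∈ Θ, ∃ c : K, (γ : WithTop G) ≤ w (a - algebraMap K F c))

-- Division from the top degree downwards, with powers of X - c absorbing the part of the leading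
-- coefficient outside A. The centre c may change at each step.
omit [Algebra k F] [IsScalarTower k K F] in
include hw hne hle in
theorem exists_add_eq_aeval (hA : IsPreTower v t A) (Γ : Cut G) (n : ℕ) (hn : n ≤ m) (f : K[X])
    (hf : f.degree < n) :
    ∃ g ∈ coeffSubmodule A Θ m Γ, ∃ z ∈ ideal w Γ, aeval a g + z = aeval a f := by
  induction n generalizing f with
  | zero =>
    rw [Nat.cast_zero, Nat.WithBot.lt_zero_iff, degree_eq_bot] at hf
    exact ⟨0, zero_mem _, 0, zero_mem _, by simp [hf]⟩
  | succ n ih =>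
    obtain ⟨p, hp, r, hr, hpr⟩ := hA.exists_add_eq (Cut.diffN Γ n Θ) (f.coeff n)
    have hr' : algebraMap K F r ∈ ideal w (Cut.diffN Γ n Θ) := fun γ hγ => by
      rw [hw]
      exact hr γ hγ
    obtain ⟨γ, hγ, hγr⟩ := exists_mul_pow_mem_ideal hne hr'
    obtain ⟨c, hc⟩ := hle γ hγ
    have hdeg : (f - monomial n p - C r * (X - C c) ^ n).degree < (n : WithBot ℕ) := by
      rw [degree_lt_iff_coeff_zero]
      intro i hi
      have hmonic : ((X - C c) ^ n).Monic := (monic_X_sub_C c).pow n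
      have hnat : ((X - C c) ^ n).natDegree = n := by
        rw [(monic_X_sub_C c).natDegree_pow, natDegree_X_sub_C, mul_one]
      rw [coeff_sub, coeff_sub, coeff_C_mul, coeff_monomial]
      rcases hi.eq_or_lt with rfl | hi
      · have : ((X - C c) ^ n).coeff n = 1 := by
          have := hmonic.coeff_natDegree
          rwa [hnat] at this
        rw [this, ← hpr]
        simp
      · rw [coeff_eq_zero_of_natDegree_lt (hnat.trans_lt hi), if_neg hi.ne,
          coeff_eq_zero_of_degree_lt (hf.trans_le (by exact_mod_cast hi))]
        simp
    obtain ⟨g, hg, z, hz, hgz⟩ := ih (by omega) _ hdeg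
    refine ⟨monomial n p + g, add_mem (monomial_mem_coeffSubmodule (by omega) hp) hg,
      algebraMap K F r * (a - algebraMap K F c) ^ n + z, add_mem (hγr _ hc) hz, ?_⟩
    rw [map_sub, map_sub] at hgz
    have : aeval a (C r * (X - C c) ^ n) = algebraMap K F r * (a - algebraMap K F c) ^ n := by
      simp
    rw [this] at hgz
    rw [map_add]
    linear_combination hgz

-- An approximation c₀ of a can be replaced by its component in A[Θ]: the discarded component e has
-- value beyond Θ, hence larger than that of a - c₀, and does not affect the quality of the
-- approximation.
omit [Algebra k F] [IsScalarTower k K F] in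
include hw hle in
theorem exists_mem_le_map_sub (hA : IsPreTower v t A)
    (hmem : ∀ (c : K) (γ : G), w (a - algebraMap K F c) = γ → γ ∈ Θ)
    (ha : ∀ c : K, a ≠ algebraMap K F c)
    {γ : G} (hγ : γ ∈ Θ) : ∃ c ∈ A Θ, (γ : WithTop G) ≤ w (a - algebraMap K F c) := by
  obtain ⟨c₀, hc₀⟩ := hle γ hγ
  obtain ⟨c, hc, e, he, rfl⟩ := hA.exists_add_eq Θ c₀
  refine ⟨c, hc, ?_⟩
  obtain ⟨δ, hδ⟩ := WithTop.ne_top_iff_exists.mp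
    (w.ne_top_iff.mpr (sub_ne_zero.mpr (ha (c + e))))
  have h1 : (δ : WithTop G) < w (algebraMap K F e) := by
    rw [hw]
    exact he δ (hmem _ _ hδ.symm)
  have h2 : a - algebraMap K F c = (a - algebraMap K F (c + e)) + algebraMap K F e := by
    rw [map_add]
    ring
  rw [h2, w.map_add_eq_of_lt_left (by rwa [← hδ])]
  exact hc₀

/-- Each term lies in A[Γ - (j + i)Θ] A[jΘ], and adding iΘ to the sum of the two cuts stays below Γ.
Here multiplicativity of A is essential. -/
theorem eval_hasseDeriv_mem (hA : IsTower v t A) (ht : t 0 = 1) {Γ : Cut G} {f : K[X]}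
    (hf : f ∈ coeffSubmodule A Θ m Γ) {c : K} (hc : c ∈ A Θ) (i : ℕ) :
    (hasseDeriv i f).eval c ∈ A (Cut.diffN Γ i Θ) := by
  rw [eval_eq_sum_range]
  refine sum_mem fun j _ => ?_
  rw [hasseDeriv_coeff, mul_assoc, ← nsmul_eq_mul]
  refine nsmul_mem (hA.mul_mem_of_le (hf.2 (j + i)) (hA.pow_mem ht hc j) ?_) _
  rw [Cut.le_diffN_iff, add_assoc, ← add_nsmul]
  exact Cut.diffN_add_le _ _ _

omit [Algebra k F] [IsScalarTower k K F] in
include hw hne hle in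
theorem eq_zero_of_aeval_mem_ideal (hA : IsTower v t A) (ht : t 0 = 1)
    (hmem : ∀ (c : K) (γ : G), w (a - algebraMap K F c) = γ → γ ∈ Θ)
    (ha : ∀ c : K, a ≠ algebraMap K F c)
    (hmin : ∀ f : K[X], f ≠ 0 → f.natDegree < m → aeval a f ≠ 0 ∧ ∃ γ ∈ Θ, ∀ i, 0 < i →
      w (aeval a f) < w (aeval a (hasseDeriv i f)) + i • (γ : WithTop G))
    {Γ : Cut G} {f : K[X]} (hf : f ∈ coeffSubmodule A Θ m Γ) (hfΓ : aeval a f ∈ ideal w Γ) :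
    f = 0 := by
  by_contra hf0
  have hdeg : f.natDegree < m := (natDegree_lt_iff_degree_lt hf0).mpr hf.1
  have hex : ∀ i, ∃ γ ∈ Θ, hasseDeriv i f ≠ 0 → ∀ j, 0 < j → w (aeval a (hasseDeriv i f)) <
      w (aeval a (hasseDeriv j (hasseDeriv i f))) + j • (γ : WithTop G) := by
    intro i
    by_cases hi : hasseDeriv i f = 0
    · obtain ⟨γ, hγ⟩ := hne
      exact ⟨γ, hγ, fun h => absurd hi h⟩
    · obtain ⟨γ, hγ, h⟩ := (hmin _ hi
        ((natDegree_hasseDeriv_le f i).trans_lt (by omega))).2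
      exact ⟨γ, hγ, fun _ => h⟩
  choose γ hγΘ hγ using hex
  -- The largest of the finitely many thresholds yields one centre c that serves all Hasse
  -- derivatives of f.
  obtain ⟨i₀, -, hi₀⟩ := Finset.exists_max_image (Finset.range (f.natDegree + 1)) γ ⟨0, by simp⟩
  obtain ⟨c, hc, hcγ⟩ := exists_mem_le_map_sub hw hle hA.toIsPreTower hmem ha (hγΘ i₀)
  refine hf0 (eq_zero_of_hasseDeriv_eq_zero f c fun i => ?_)
  by_contra hi
  have hi0 : hasseDeriv i f ≠ 0 := fun h => hi (by simp [h])
  have hidx : ∀ i, hasseDeriv i f ≠ 0 → γ i ≤ γ i₀ := by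
    intro i hi
    refine hi₀ i (Finset.mem_range.mpr ?_)
    by_contra h
    exact hi (hasseDeriv_eq_zero_of_lt_natDegree f i (by omega))
  have hval : v ((hasseDeriv i f).eval c) = w (aeval a (hasseDeriv i f)) := by
    refine map_eval_eq hw (γ := γ i) ((WithTop.coe_le_coe.mpr (hidx i hi0)).trans hcγ)
      (hmin _ hi0 ((natDegree_hasseDeriv_le f i).trans_lt (by omega))).1 (hγ i hi0)
  refine hi (hA.eq_zero_of_mem (eval_hasseDeriv_mem hA ht hf hc i) fun δ hδ => ?_)
  have h0 : hasseDeriv 0 f ≠ 0 := by rwa [hasseDeriv_zero']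
  -- Since f(a) ∈ O[Γ], its value exceeds δ + i γ₀; comparing with the upper bound w(f_i(a)) + i γ₀
  -- and cancelling i γ₀ gives δ < w(f_i(a)).
  have h1 : δ + i • γ 0 ∈ Γ := Cut.mem_diffN.mp hδ _ (Cut.nsmul_mem_nsmul (hγΘ 0) i)
  have h2 : w (aeval a f) ≤ w (aeval a (hasseDeriv i f)) + i • (γ 0 : WithTop G) := by
    rcases Nat.eq_zero_or_pos i with rfl | hipos
    · simp
    · have := hγ 0 h0 i hipos
      rw [hasseDeriv_zero'] at this
      exact this.le
  have h3 := (hfΓ _ h1).trans_le h2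
  rw [WithTop.coe_add, WithTop.coe_nsmul] at h3
  rw [hval]
  exact lt_of_add_lt_add_right h3

end Complement

end Extension

/-! ### Weak tower axioms and the multiplicativity criterion -/

section Extension

variable {G : Type*} [AddCommGroup G] [LinearOrder G] [IsOrderedAddMonoid G]
variable {k K F : Type*} [Field k] [Field K] [Field F]
  [Algebra k K] [Algebra K F] [Algebra k F] [IsScalarTower k K F]
  {v : AddValuation K (WithTop G)} {t : G → K} {w : AddValuation F (WithTop G)}
  {A : Cut G → Submodule k K} {Θ : Cut G} {m : ℕ} {a : F} {B : Cut G → Submodule k F}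

theorem isWeakTower_of_isCompl (hA : IsTower v t A) (ht : IsValueGroupSection v t)
    (hw : ∀ x : K, w (algebraMap K F x) = v x) (hm : 0 < m)
    (hB : ∀ Γ x, x ∈ B Γ ↔ ∃ f ∈ coeffSubmodule A Θ m Γ, aeval a f = x)
    (hcompl : ∀ Λ : Cut G, IsCompl (B Λ).toAddSubgroup (ideal w Λ)) :
    IsWeakTower w (fun γ => algebraMap K F (t γ)) B := by
  have htne : ∀ γ, t γ ≠ 0 := fun γ h => by
    have := ht.val γ
    rw [h, v.map_zero] at this
    exact WithTop.top_ne_coe this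
  have hsub : ∀ (γ : G) (Λ : Cut G) (x : F), x ∈ B Λ → algebraMap K F (t γ) * x ∈ B (γ +ᵥ Λ) := by
    intro γ Λ x hx
    obtain ⟨f, hf, rfl⟩ := (hB _ _).mp hx
    refine (hB _ _).mpr ⟨C (t γ) * f, ⟨(degree_C_mul (htne γ)).trans_lt hf.1, fun n => ?_⟩, by simp⟩
    rw [coeff_C_mul, Cut.diffN_vadd]
    exact hA.monomial_mul_mem γ (hf.2 n)
  refine ⟨IsPreTower.of_isCompl (fun γ => by rw [hw, ht.val]) hcompl (fun γ c => ?_)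
    fun Γ Λ h x hx => ?_, fun γ Λ => ?_⟩
  · exact (hB _ _).mpr ⟨monomial 0 (c • t γ),
      monomial_mem_coeffSubmodule hm (by simpa using hA.monomial_mem γ c),
      by rw [aeval_monomial, pow_zero, mul_one, Algebra.algebraMap_eq_smul_one, smul_assoc,
        ← Algebra.algebraMap_eq_smul_one]⟩
  · obtain ⟨f, hf, rfl⟩ := (hB _ _).mp hx
    exact (hB _ _).mpr ⟨f, coeffSubmodule_mono hA.toIsPreTower h hf, rfl⟩
  · ext x
    constructor
    · intro hx
      -- The reverse inclusion is the inclusion for -γ, because t(-γ) inverts t(γ).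
      refine ⟨algebraMap K F (t (-γ)) * x, ?_, ?_⟩
      · have := hsub (-γ) _ x hx
        rwa [neg_vadd_vadd] at this
      · simp only
        rw [ht.neg, map_inv₀, mul_inv_cancel_left₀]
        simpa using htne γ
    · rintro ⟨y, hy, rfl⟩
      exact hsub γ Λ y hy

-- Split c along A[Γ] ⊕ O[Γ] in K; the O[Γ]-component then lies in B[Γ] ∩ O[Γ] = 0.
omit [IsScalarTower k K F] in
theorem algebraMap_mem_iff (hA : IsPreTower v t A) (hw : ∀ x : K, w (algebraMap K F x) = v x)
    (hm : 0 < m) (hB : ∀ Γ x, x ∈ B Γ ↔ ∃ f ∈ coeffSubmodule A Θ m Γ, aeval a f = x)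
    (hcompl : ∀ Λ : Cut G, IsCompl (B Λ).toAddSubgroup (ideal w Λ)) (Γ : Cut G) (c : K) :
    algebraMap K F c ∈ B Γ ↔ c ∈ A Γ := by
  have hsub : ∀ c ∈ A Γ, algebraMap K F c ∈ B Γ := fun c hc =>
    (hB _ _).mpr ⟨monomial 0 c, monomial_mem_coeffSubmodule hm (by simpa using hc), by simp⟩
  refine ⟨fun hc => ?_, hsub c⟩
  obtain ⟨y, hy, z, hz, rfl⟩ := hA.exists_add_eq Γ c
  have h1 : algebraMap K F z ∈ B Γ := by
    have := sub_mem hc (hsub y hy)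
    rwa [← map_sub, add_sub_cancel_left] at this
  have h2 : algebraMap K F z ∈ ideal w Γ := fun γ hγ => by
    rw [hw]
    exact hz γ hγ
  have h3 : algebraMap K F z = 0 :=
    AddSubgroup.mem_bot.mp ((hcompl Γ).disjoint.le_bot ⟨h1, h2⟩)
  rw [map_eq_zero] at h3
  rwa [h3, add_zero]

omit [IsScalarTower k K F] in
theorem coeff_minpoly_mem_of_isTower {s : G → F} (hA : IsTower v t A) (ht : t 0 = 1)
    (hm : 1 < m) (hint : IsIntegral K a) (hdeg : (minpoly K a).natDegree = m)
    (hB : ∀ Γ x, x ∈ B Γ ↔ ∃ f ∈ coeffSubmodule A Θ m Γ, aeval a f = x)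
    (hT : IsTower w s B) (hs : s 0 = 1) {j : ℕ} (hj : j < m) :
    (minpoly K a).coeff j ∈ A (Cut.diffN (m • Θ) j Θ) := by
  have ha : a ∈ B Θ := by
    refine (hB _ _).mpr ⟨monomial 1 1, monomial_mem_coeffSubmodule hm ?_, by simp [aeval_monomial]⟩
    refine hA.mono ?_ (hA.one_mem ht)
    rw [Cut.le_diffN_iff, zero_add, one_nsmul]
  obtain ⟨f, hf, hfa⟩ := (hB _ _).mp (hT.pow_mem hs ha m)
  have hmonic := minpoly.monic hint
  -- With f(a) = a^m and deg f < m, X^m - f is monic of degree m with root a, so it must be the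
  -- minimal polynomial.
  have hlt : (X ^ m - f - minpoly K a).degree < (minpoly K a).degree := by
    rw [degree_eq_natDegree hmonic.ne_zero, hdeg, degree_lt_iff_coeff_zero]
    intro i hi
    rw [coeff_sub, coeff_sub, coeff_X_pow,
      coeff_eq_zero_of_degree_lt (hf.1.trans_le (by exact_mod_cast hi))]
    rcases hi.eq_or_lt with rfl | hi
    · have := hmonic.coeff_natDegree
      rw [hdeg] at this
      simp [this]
    · rw [if_neg hi.ne', coeff_eq_zero_of_natDegree_lt (hdeg.trans_lt hi)]
      simp
  have hzero : X ^ m - f - minpoly K a = 0 := by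
    by_contra h
    exact hlt.not_ge (minpoly.degree_le_of_ne_zero K a h (by simp [hfa]))
  rw [← sub_eq_zero.mp hzero, coeff_sub, coeff_X_pow, if_neg hj.ne, zero_sub]
  exact neg_mem (hf.2 j)

-- Substituting for a^m strictly lowers the exponent, from m + l to j + l with j < m, and the bounds
-- on the b_j keep each new coefficient in the subspace required for its exponent.
omit [IsScalarTower k K F] in
theorem monomial_mem_of_coeff_minpoly_mem (hA : IsTower v t A) (hint : IsIntegral K a)
    (hdeg : (minpoly K a).natDegree = m)
    (hB : ∀ Γ x, x ∈ B Γ ↔ ∃ f ∈ coeffSubmodule A Θ m Γ, aeval a f = x)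
    (hp : ∀ j < m, (minpoly K a).coeff j ∈ A (Cut.diffN (m • Θ) j Θ)) (Γ : Cut G) (n : ℕ) :
    ∀ c ∈ A (Cut.diffN Γ n Θ), algebraMap K F c * a ^ n ∈ B Γ := by
  induction n using Nat.strong_induction_on with
  | _ n ih =>
    intro c hc
    rcases lt_or_ge n m with hn | hn
    · exact (hB _ _).mpr ⟨monomial n c, monomial_mem_coeffSubmodule hn hc, by simp [aeval_monomial]⟩
    · obtain ⟨l, rfl⟩ := Nat.exists_eq_add_of_le hn
      have hpow : a ^ m = -∑ j ∈ Finset.range m, algebraMap K F ((minpoly K a).coeff j) * a ^ j := by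
        have h := minpoly.aeval K a
        have hlead := (minpoly.monic hint).coeff_natDegree
        rw [aeval_eq_sum_range, Finset.sum_range_succ, hlead, one_smul, hdeg] at h
        simp only [Algebra.smul_def] at h
        linear_combination h
      have hexp : algebraMap K F c * a ^ (m + l) = ∑ j ∈ Finset.range m,
          -(algebraMap K F (c * (minpoly K a).coeff j) * a ^ (j + l)) := by
        rw [pow_add, hpow, Finset.sum_neg_distrib, neg_mul, mul_neg, Finset.sum_mul,
          Finset.mul_sum]
        congr 1
        refine Finset.sum_congr rfl fun j _ => ?_
        rw [map_mul, pow_add]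
        ring
      rw [hexp]
      refine sum_mem fun j hj => neg_mem ?_
      have hj := Finset.mem_range.mp hj
      refine ih (j + l) (by omega) _ (hA.mul_mem_of_le hc (hp j hj) ?_)
      rw [Cut.le_diffN_iff]
      calc Cut.diffN Γ (m + l) Θ + Cut.diffN (m • Θ) j Θ + (j + l) • Θ
          = Cut.diffN Γ (m + l) Θ + ((Cut.diffN (m • Θ) j Θ + j • Θ) + l • Θ) := by
            rw [add_nsmul]
            simp only [add_assoc]
        _ ≤ Cut.diffN Γ (m + l) Θ + (m • Θ + l • Θ) :=
            Cut.add_le_add le_rfl (Cut.add_le_add (Cut.diffN_add_le _ _ _) le_rfl)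
        _ ≤ Γ := by
            rw [← add_nsmul]
            exact Cut.diffN_add_le _ _ _

omit [IsScalarTower k K F] in
theorem mul_mem_of_coeff_minpoly_mem (hA : IsTower v t A) (hint : IsIntegral K a)
    (hdeg : (minpoly K a).natDegree = m)
    (hB : ∀ Γ x, x ∈ B Γ ↔ ∃ f ∈ coeffSubmodule A Θ m Γ, aeval a f = x)
    (hp : ∀ j < m, (minpoly K a).coeff j ∈ A (Cut.diffN (m • Θ) j Θ)) (Γ Δ : Cut G) (x y : F)
    (hx : x ∈ B Γ) (hy : y ∈ B Δ) : x * y ∈ B (Γ + Δ) := by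
  obtain ⟨f, hf, rfl⟩ := (hB _ _).mp hx
  obtain ⟨g, hg, rfl⟩ := (hB _ _).mp hy
  rw [aeval_eq_sum_range, aeval_eq_sum_range, Finset.sum_mul_sum]
  refine sum_mem fun i _ => sum_mem fun j _ => ?_
  have h := monomial_mem_of_coeff_minpoly_mem hA hint hdeg hB hp (Γ + Δ) (i + j)
    (f.coeff i * g.coeff j) (hA.mul_mem_of_le (hf.2 i) (hg.2 j) ?_)
  · convert h using 1
    rw [Algebra.smul_def, Algebra.smul_def, map_mul, pow_add]
    ring
  · rw [Cut.le_diffN_iff]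
    calc Cut.diffN Γ i Θ + Cut.diffN Δ j Θ + (i + j) • Θ
        = (Cut.diffN Γ i Θ + i • Θ) + (Cut.diffN Δ j Θ + j • Θ) := by
          rw [add_nsmul, add_add_add_comm]
      _ ≤ Γ + Δ := Cut.add_le_add (Cut.diffN_add_le _ _ _) (Cut.diffN_add_le _ _ _)

end Extension

/-! ### The breadth cut and the generator of F -/

section

variable {G : Type*} [AddCommGroup G] [LinearOrder G] [IsOrderedAddMonoid G]
  {K F : Type*} [Field K] [Field F] [Algebra K F]
  {v : AddValuation K (WithTop G)} {w : AddValuation F (WithTop G)} {a : F}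

theorem mem_breadth_of_eq {c : K} {γ : G} (h : w (a - algebraMap K F c) = γ) :
    γ ∈ breadth K w a := subset_lowerClosure ⟨c, h⟩

theorem exists_le_of_mem_breadth {γ : G} (h : γ ∈ breadth K w a) :
    ∃ c : K, (γ : WithTop G) ≤ w (a - algebraMap K F c) := by
  obtain ⟨δ, ⟨c, hc⟩, hle⟩ := mem_lowerClosure.mp h
  exact ⟨c, hc ▸ WithTop.coe_le_coe.mpr hle⟩

theorem ne_algebraMap_of_isPseudoLimit (hw : ∀ x : K, w (algebraMap K F x) = v x) {I : Type*}
    [LinearOrder I] {u : I → K} (hlimK : ∀ c : K, ¬ IsPseudoLimit v u c)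
    (hlim : IsPseudoLimit w (fun ν => algebraMap K F (u ν)) a) (c : K) :
    a ≠ algebraMap K F c := by
  rintro rfl
  refine hlimK c fun ρ σ h => ?_
  simpa only [← map_sub, hw] using hlim ρ σ h

theorem exists_aeval_eq_of_adjoin_eq_top (ha : K⟮a⟯ = ⊤) (hint : IsIntegral K a) (x : F) :
    ∃ f : K[X], f.degree < (minpoly K a).natDegree ∧ aeval a f = x := by
  have hx : x ∈ K⟮a⟯.toSubalgebra := by
    rw [ha]
    trivial
  rw [adjoin_simple_toSubalgebra_of_isAlgebraic hint.isAlgebraic,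
    Algebra.adjoin_singleton_eq_range_aeval] at hx
  obtain ⟨f, rfl⟩ := hx
  refine ⟨f %ₘ minpoly K a, ?_, aeval_modByMonic_eq_self_of_root (minpoly.aeval K a)⟩
  rw [← degree_eq_natDegree (minpoly.ne_zero hint)]
  exact degree_modByMonic_lt _ (minpoly.monic hint)

end

end TowerOfComplements

theorem mainTheorem7
    {G : Type*} [AddCommGroup G] [LinearOrder G] [IsOrderedAddMonoid G]
    {k K F : Type*} [Field k] [Field K] [Field F]
    [Algebra k K] [Algebra K F] [Algebra k F] [IsScalarTower k K F]
    -- the valued field `K` with its sections and its tower of complements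
    (v : AddValuation K (WithTop G)) (t : G → K)
    (hk : TowerOfComplements.IsResidueSection k v)
    (ht : TowerOfComplements.IsValueGroupSection v t)
    (A : TowerOfComplements.Cut G → Submodule k K)
    (hA : TowerOfComplements.IsTower v t A)
    -- the valued field extension `F = K(a)`
    (w : AddValuation F (WithTop G)) (hw : ∀ x : K, w (algebraMap K F x) = v x)
    (a : F) (ha : K⟮a⟯ = ⊤)
    -- a pseudo Cauchy sequence in `K` of algebraic type, without limit in `K`, with limit `a`
    {I : Type*} [LinearOrder I] [WellFoundedLT I] [Nonempty I] [NoMaxOrder I]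
    (u : I → K)
    (hu : TowerOfComplements.IsPseudoCauchy v u)
    (hlimK : ∀ c : K, ¬ TowerOfComplements.IsPseudoLimit v u c)
    (hlim : TowerOfComplements.IsPseudoLimit w (fun ν => algebraMap K F (u ν)) a)
    -- `a` is a root of a minimal polynomial of the sequence, of degree `m`
    (q : K[X]) (hq : TowerOfComplements.IsMinimalPolynomialOf v u q)
    (hroot : aeval a q = 0)
    (m : ℕ) (hm : m = q.natDegree)
    -- the cut `Λ_a` and the family `B`
    (Λ : TowerOfComplements.Cut G) (hΛ : Λ = TowerOfComplements.breadth K w a)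
    (B : TowerOfComplements.Cut G → Submodule k F)
    (hB : B = TowerOfComplements.extension A Λ m a) :
    -- `B` is a weak tower of complements for `F` that extends `A`
    (TowerOfComplements.IsWeakTower w (fun γ => algebraMap K F (t γ)) B ∧
      ∀ (Γ : TowerOfComplements.Cut G) (c : K), algebraMap K F c ∈ B Γ ↔ c ∈ A Γ) ∧
    -- the criterion
    (TowerOfComplements.IsTower w (fun γ => algebraMap K F (t γ)) B ↔
      Λ = ⊤ ∨ ∀ j : ℕ, j < m →
        (minpoly K a).coeff j ∈ A (TowerOfComplements.Cut.diffN (m • Λ) j Λ)) := by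

  open TowerOfComplements in
  obtain ⟨g, hg, hag⟩ := exists_strictMono_eq_map_sub hw hu hlim
  obtain ⟨hint, hdeg⟩ := hq.natDegree_minpoly hw hg hag hroot
  rw [← hm] at hdeg
  have haK := ne_algebraMap_of_isPseudoLimit hw hlimK hlim
  -- Degree 1 would put a in K, where the sequence has no limit. The strict bound makes a itself one
  -- of the monomials spanning B.
  have hm1 : 1 < m := by
    have hpos := minpoly.natDegree_pos hint
    by_contra h
    have h1 : (minpoly K a).natDegree = 1 := by omega
    obtain ⟨c, hc⟩ := minpoly.natDegree_eq_one_iff.mp h1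
    exact haK c hc.symm
  have hm0 : 0 < m := by omega
  have hF := exists_aeval_eq_of_adjoin_eq_top ha hint
  rw [hdeg] at hF
  have hBmem : ∀ Γ x, x ∈ B Γ ↔ ∃ f ∈ coeffSubmodule A Λ m Γ, aeval a f = x := fun Γ x => by
    rw [hB]
    exact mem_extension_iff hA.toIsPreTower hm0 hF
  have hmem : ∀ (c : K) (γ : G), w (a - algebraMap K F c) = γ → γ ∈ Λ :=
    fun c γ h => hΛ ▸ mem_breadth_of_eq h
  have hle : ∀ γ ∈ Λ, ∃ c : K, (γ : WithTop G) ≤ w (a - algebraMap K F c) :=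
    fun γ h => exists_le_of_mem_breadth (hΛ ▸ h)
  have hgΛ : ∀ ν, g ν ∈ Λ := fun ν => hmem _ _ (hag ν)
  have hne : ∃ γ, γ ∈ Λ := ⟨_, hgΛ (Classical.arbitrary I)⟩
  have hmin : ∀ f : K[X], f ≠ 0 → f.natDegree < m → aeval a f ≠ 0 ∧ ∃ γ ∈ Λ, ∀ i, 0 < i →
      w (aeval a f) < w (aeval a (hasseDeriv i f)) + i • (γ : WithTop G) := by
    intro f hf hfm
    obtain ⟨h0, h⟩ := hq.eventually_lt hw hg hag hf (hm ▸ hfm)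
    obtain ⟨ν, hν⟩ := h.exists
    exact ⟨h0, g ν, hgΛ ν, hν⟩
  have hcompl : ∀ Γ : Cut G, IsCompl (B Γ).toAddSubgroup (ideal w Γ) := by
    intro Γ
    constructor
    · rw [disjoint_iff_inf_le]
      rintro x ⟨hx, hxΓ⟩
      obtain ⟨f, hf, rfl⟩ := (hBmem Γ x).mp hx
      rw [eq_zero_of_aeval_mem_ideal hw hne hle hA ht.zero hmem haK hmin hf hxΓ, map_zero]
      exact zero_mem _
    · rw [codisjoint_iff_le_sup]
      intro x _
      obtain ⟨f, hf, rfl⟩ := hF x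
      obtain ⟨f', hf', z, hz, h⟩ := exists_add_eq_aeval hw hne hle hA.toIsPreTower Γ m le_rfl f hf
      exact AddSubgroup.mem_sup.mpr ⟨_, (hBmem Γ _).mpr ⟨f', hf', rfl⟩, z, hz, h⟩
  have hweak := isWeakTower_of_isCompl hA ht hw hm0 hBmem hcompl
  refine ⟨⟨hweak, algebraMap_mem_iff hA.toIsPreTower hw hm0 hBmem hcompl⟩, fun hT => ?_, fun h => ?_⟩
  · exact Or.inr fun j hj => coeff_minpoly_mem_of_isTower hA ht.zero hm1 hint hdeg hBmem hT
      (by simp [ht.zero]) hj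
  · refine ⟨hweak.toIsPreTower, mul_mem_of_coeff_minpoly_mem hA hint hdeg hBmem fun j hj => ?_⟩
    rcases h with rfl | h
    · rw [Cut.nsmul_top hm0, Cut.diffN_top_left]
      exact hA.toIsPreTower.mem_top _
    · exact h j hj
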